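/- **Setting.** A (disjunctive) program $\Pi$ is a finite set of rules $r$ with head $H_r$, positive body $B_r^+$ and negative body $B_r^-$ (pairwise disjoint finite sets of atoms); $\mathrm{at}(r)=H_r\cup B^+_r\cup B^-_r$, $\mathrm{at}(\Pi)=\bigcup_{r\in\Pi}\mathrm{at}(r)$. An answer set of $\Pi$ is a minimal model $I$ of the Gelfond–Lifschitz reduct $\Pi^I$. An instance of $\#\mathrm{PAS}$ is a pair $(\Pi,P)$ with $P\subseteq \mathrm{at}(\Pi)$; its *projected answer sets count* is the number of sets $I\subseteq P$ such that $I\cup J$ is an answer set of $\Pi$ for some $J\subseteq\mathrm{at}(\Pi)\setminus P$. The primal graph $G_\Pi$ has vertex set $\mathrm{at}(\Pi)$, two distinct atoms being adjacent iff they occur together in a rule. Let $(T,\chi)$ be a nice tree decomposition of $G_\Pi$ with root $n$ (every node is a leaf, introduce, remove or join node, join nodes have non-empty bags, and root and leaf bags are empty), and let $t_1,\dots,t_\ell$ be the children of $t$. Put $\Pi_t=\{r\in\Pi:\mathrm{at}(r)\subseteq\chi(t)\}$, and let $\Pi_{\le t}$ and $\mathrm{at}_{\le t}$ be the unions of the $\Pi_{t'}$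 and of the $\chi(t')$ over the nodes $t'$ of the subtree rooted at $t$. **First pass.** A table algorithm $\mathbb A$ computes, at a node $t$, a finite set of rows (a table) from $t$, $\chi(t)$, $(\Pi_t,P)$, an input table for $t$ and the tables of the children of $t$; the first component $\mathcal I(u)$ of a row $u$ is a set of atoms. $\mathtt{DP}_{\mathbb A}$ applies $\mathbb A$ bottom-up with empty input tables, which gives the table mapping $\tau$. For a row $u$, $\mathrm{orig}(t,u)$ is the set of $s\in\tau(t_1)\times\dots\times\tau(t_\ell)$ such that $\mathbb A$ run at $t$ on the child tables $\{s_1\},\dots,\{s_\ell\}$ produces a table containing $u$; $\mathrm{origs}(t,\rho)=\bigcup_{u\in\rho}\mathrm{orig}(t,u)$. The set $\mathrm{Ext}_{\le t}(u)$ of extensions of $u$ below $t$ is $\{\{(t,u)\}\}$ if $t$ is a leaf, and otherwise consists of all $\{(t,u)\}\cup X_1\cup\dots\cup X_\ell$ with $s\in\mathrm{orig}(t,u)$ and $X_j\in\mathrm{Ext}_{\le t_j}(s_j)$ for every $j$. Let $\mathrm{PExt}_{\le t}$ be the set of all $X\in\bigcup_{u\in\tau(t)}\mathrm{Ext}_{\le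 t}(u)$ that are contained in some $Y\in\bigcup_{u\in\tau(n)}\mathrm{Ext}_{\le n}(u)$; let $\mathcal I(\mathrm{PExt}_{\le t})=\{\bigcup_{(t',u)\in X}\mathcal I(u): X\in\mathrm{PExt}_{\le t}\}$; and let the purged table $\nu(t)$ be the set of rows $u$ of $\tau(t)$ such that $(t,u)\in X$ for some $X\in\mathrm{PExt}_{\le t}$. **Admissibility.** $\mathbb A$ is *admissible on* $(\Pi,P)$ and $(T,\chi)$ if for all nodes $t$: (1) $\mathcal I(u)\subseteq\chi(t)$ for all $u\in\tau(t)$; (2) $\mathcal I(s_j)\cap\chi(t_j)\cap\chi(t)=\mathcal I(u)\cap\chi(t_j)\cap\chi(t)$ for all $u\in\tau(t)$, $s\in\mathrm{orig}(t,u)$ and all $j$; (3) $\mathcal I(\mathrm{PExt}_{\le t})$ is the set of all $I\subseteq\mathrm{at}_{\le t}$ such that $I\models\Pi_{\le t}$ and there is an answer set $I'$ of $\Pi$ with $I\subseteq I'\subseteq I\cup(\mathrm{at}(\Pi)\setminus\mathrm{at}_{\le t})$; (4) if $t=n$ or $t$ is a leaf, at most one row $u$ satisfies $(t,u)\in X$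 for some $X\in\mathrm{PExt}_{\le t}$. $\mathbb A$ is *admissible for a class $\mathcal C$ of programs* if it is admissible on every instance $(\Pi,P)$ with $\Pi\in\mathcal C$ and every nice tree decomposition of $G_\Pi$. **Second pass.** $\mathtt{DP}_{\mathtt{PROJ}}$ computes bottom-up $\pi(t)=\{(\rho,\mathrm{ipmc}(t,\rho)):\rho\in\mathrm{subbuckets}_P(\nu(t))\}$. Here $\mathrm{subbuckets}_P(\nu(t))$ is the set of non-empty subsets of the classes of $\nu(t)$ under the relation $\mathcal I(u)\cap P=\mathcal I(v)\cap P$. Further, $\mathrm{ipmc}(t,\rho)=1$ if $t$ is a leaf, and otherwise $$\mathrm{ipmc}(t,\rho)=\Bigl|\,\mathrm{pmc}(t,\rho)+\sum_{\emptyset\subsetneq\varphi\subsetneq\rho}(-1)^{|\varphi|}\,\mathrm{ipmc}(t,\varphi)\Bigr|,$$ $$\mathrm{pmc}(t,\rho)=\sum_{\emptyset\subsetneq O\subseteq \mathrm{origs}(t,\rho)}(-1)^{|O|-1}\prod_{j=1}^{\ell}\mathrm{sipmc}\bigl(\pi(t_j),\{s_j:s\in O\}\bigr),$$ where $\mathrm{sipmc}(\pi(t),\rho)=\sum_{(\rho,c)\in\pi(t)}c$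 is the stored count. **Theorem.** Let $\mathbb A$ be a table algorithm. (a) For every instance $(\Pi,P)$ and every nice tree decomposition $(T,\chi)$ of $G_\Pi$ on which $\mathbb A$ is admissible, the mapping $\pi$ that $\mathtt{DP}_{\mathtt{PROJ}}$ returns on the purged tabled tree decomposition $(T,\chi,\nu)$ satisfies: the count stored at the root, $\mathrm{sipmc}(\pi(n),\nu(n))$, and also the sum of the counts $c$ of all rows $(\rho,c)\in\pi(n)$, equal the projected answer sets count of $\Pi$ with respect to $P$. (b) Consequently, if $\mathbb A$ is admissible for a class $\mathcal C$ of programs, then the algorithm $\mathtt{MDP}_{\mathbb A}$ (compute, by any procedure, a nice tree decomposition of $G_\Pi$; run $\mathtt{DP}_{\mathbb A}$; purge; run $\mathtt{DP}_{\mathtt{PROJ}}$; output the sum of the counts in $\pi(n)$) outputs the projected answer sets count for every instance $(\Pi,P)$ with $\Pi\in\mathcal C$. -/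

import Mathlib

open scoped Classical

noncomputable section

namespace PAS

universe u v w

/-! ### Disjunctive answer set programs -/

/-- A rule `a₁ ∨ ⋯ ∨ aₗ ← aₗ₊₁, …, aₘ, ¬aₘ₊₁, …, ¬aₙ` over pairwise distinct atoms. -/
structure Rule (α : Type u) where
  head : Finset α
  pos : Finset α
  neg : Finset α
  head_pos : Disjoint head pos
  head_neg : Disjoint head neg
  pos_neg : Disjoint pos neg

/-- The atoms of a rule. -/
def Rule.atoms {α : Type u} (r : Rule α) : Finset α := r.head ∪ r.pos ∪ r.neg

/-- A program is a finite set of rules. -/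
abbrev Program (α : Type u) := Finset (Rule α)

/-- The atoms of a program. -/
def atoms {α : Type u} (p : Program α) : Finset α := p.biUnion Rule.atoms

/-- The interpretation `I` satisfies the rule `r`. -/
def Rule.Sat {α : Type u} (r : Rule α) (I : Finset α) : Prop :=
  ((r.head ∪ r.neg) ∩ I).Nonempty ∨ (r.pos \ I).Nonempty

/-- `I` is a model of `p`. -/
def IsModel {α : Type u} (p : Program α) (I : Finset α) : Prop := ∀ r ∈ p, r.Sat I

/-- The rule without its negative body. -/
def Rule.positive {α : Type u} (r : Rule α) : Rule α where
  head := r.head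
  pos := r.pos
  neg := ∅
  head_pos := r.head_pos
  head_neg := Finset.disjoint_empty_right _
  pos_neg := Finset.disjoint_empty_right _

/-- The Gelfond-Lifschitz reduct of `p` under `I`. -/
def reduct {α : Type u} (p : Program α) (I : Finset α) : Program α :=
  (p.filter fun r => r.neg ∩ I = ∅).image Rule.positive

/-- `I` is an answer set of `p`: a (subset-)minimal model of the reduct of `p` under `I`. -/
def IsAnswerSet {α : Type u} (p : Program α) (I : Finset α) : Prop :=
  IsModel (reduct p I) I ∧ ∀ J : Finset α, J ⊂ I → ¬ IsModel (reduct p I) J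

/-- An instance of projected answer set counting: a program and a set of projection atoms. -/
structure Instance (α : Type u) where
  prog : Program α
  proj : Finset α
  proj_subset : proj ⊆ atoms prog

/-- The projected answer sets count: the number of sets `I ⊆ P` such that `I ∪ J` is an answer set
for some set `J` of non-projection atoms. -/
def projectedCount {α : Type u} (i : Instance α) : ℕ :=
  (i.proj.powerset.filter fun I =>
    ∃ J : Finset α, J ⊆ atoms i.prog \ i.proj ∧ IsAnswerSet i.prog (I ∪ J)).card

/-- The primal graph: its vertices are the atoms of `p`; two distinct atoms are adjacent if they
occur together in a rule. -/
def primalGraph {α : Type u} (p : Program α) : (⊤ : SimpleGraph α).Subgraph where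
  verts := {a | a ∈ atoms p}
  Adj a b := a ≠ b ∧ ∃ r ∈ p, a ∈ r.atoms ∧ b ∈ r.atoms
  adj_sub h := h.1
  edge_vert := by
    rintro a b ⟨_, r, hr, ha, _⟩
    exact Finset.mem_biUnion.2 ⟨r, hr, ha⟩
  symm := ⟨by
    rintro a b ⟨hne, r, hr, ha, hb⟩
    exact ⟨hne.symm, r, hr, hb, ha⟩⟩

/-! ### Rooted trees with bags, nice tree decompositions -/

/-- A finite rooted tree (every node has an ordered sequence of children; every node is reached
from the root; the root is nobody's child; every other node is a child in exactly one way) whose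
nodes are labelled by bags. -/
structure BagTree (α : Type u) where
  Node : Type
  fintypeNode : Fintype Node
  root : Node
  arity : Node → ℕ
  child : (t : Node) → Fin (arity t) → Node
  child_injective : Function.Injective fun x : (Σ t : Node, Fin (arity t)) => child x.1 x.2
  child_ne_root : ∀ t i, child t i ≠ root
  reachable : ∀ t, Relation.ReflTransGen (fun a b => ∃ i, b = child a i) root t
  bag : Node → Finset α

attribute [instance] BagTree.fintypeNode

namespace BagTree

variable {α : Type u} (T : BagTree α)

/-- `T.IsChild b a`: the node `b` is a child of the node `a`. -/
def IsChild (b a : T.Node) : Prop := ∃ i, b = T.child a i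

/-- The nodes of the sub-tree rooted at `t`. -/
def below (t : T.Node) : Finset T.Node :=
  Finset.univ.filter fun s => Relation.ReflTransGen (fun a b => T.IsChild b a) t s

/-- The underlying undirected graph of the tree. -/
def graph : SimpleGraph T.Node := SimpleGraph.fromRel fun a b => T.IsChild b a

/-- `T` is a tree decomposition of `G`. -/
structure IsTreeDecomposition (G : (⊤ : SimpleGraph α).Subgraph) : Prop where
  bags_cover : {a | ∃ t, a ∈ T.bag t} = G.verts
  edge_cover : ∀ a b, G.Adj a b → ∃ t, a ∈ T.bag t ∧ b ∈ T.bag t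
  path_inter : ∀ (r s t : T.Node) (q : T.graph.Walk r t), q.IsPath → s ∈ q.support →
    T.bag r ∩ T.bag t ⊆ T.bag s

def IsLeaf (t : T.Node) : Prop := T.arity t = 0

def IsJoin (t : T.Node) : Prop :=
  T.arity t = 2 ∧ (∀ i, T.bag (T.child t i) = T.bag t) ∧ (T.bag t).Nonempty

def IsIntroduce (t : T.Node) : Prop :=
  T.arity t = 1 ∧
    ∀ i, T.bag (T.child t i) ⊆ T.bag t ∧ (T.bag t).card = (T.bag (T.child t i)).card + 1

def IsRemove (t : T.Node) : Prop :=
  T.arity t = 1 ∧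
    ∀ i, T.bag t ⊆ T.bag (T.child t i) ∧ (T.bag (T.child t i)).card = (T.bag t).card + 1

/-- `T` is a nice tree decomposition of `G`. -/
structure IsNiceTreeDecomposition (G : (⊤ : SimpleGraph α).Subgraph) : Prop
    extends T.IsTreeDecomposition G where
  node_type : ∀ t, T.IsLeaf t ∨ T.IsJoin t ∨ T.IsIntroduce t ∨ T.IsRemove t
  root_bag : T.bag T.root = ∅
  leaf_bag : ∀ t, T.IsLeaf t → T.bag t = ∅

/-- The bag-program at `t`: the rules all of whose atoms are in the bag. -/
def bagProgram (p : Program α) (t : T.Node) : Program α := p.filter fun r => r.atoms ⊆ T.bag t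

/-- The program below `t`. -/
def programBelow (p : Program α) (t : T.Node) : Program α := (T.below t).biUnion (T.bagProgram p)

/-- The atoms below `t`. -/
def atomsBelow (t : T.Node) : Finset α := (T.below t).biUnion T.bag

/-- Descending along children terminates. -/
theorem isChild_wf : WellFounded T.IsChild := by
  have key : ∀ t, ¬ Relation.TransGen T.IsChild t t := by
    intro t
    have hinj : ∀ a b c, T.IsChild c a → T.IsChild c b → a = b := by
      rintro a b c ⟨i, hi⟩ ⟨j, hj⟩
      have h := @T.child_injective ⟨a, i⟩ ⟨b, j⟩ (hi.symm.trans hj)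
      exact congrArg Sigma.fst h
    induction T.reachable t with
    | refl =>
      intro h
      obtain ⟨b, hb, _⟩ := Relation.TransGen.head'_iff.1 h
      obtain ⟨i, hi⟩ := hb
      exact T.child_ne_root b i hi.symm
    | tail _ hbc ih =>
      rename_i b c _
      intro h
      obtain ⟨d, hd, hdc⟩ := Relation.TransGen.head'_iff.1 h
      have hbd : b = d := hinj _ _ _ hbc hd
      subst hbd
      exact ih (Relation.TransGen.tail' hdc hbc)
  have : IsTrans T.Node (Relation.TransGen T.IsChild) := ⟨fun _ _ _ => Relation.TransGen.trans⟩
  have : Std.Irrefl (Relation.TransGen T.IsChild) := ⟨key⟩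
  exact Subrelation.wf (fun h => Relation.TransGen.single h)
    (Finite.wellFounded_of_trans_of_irrefl (Relation.TransGen T.IsChild))

end BagTree

/-! ### Table algorithms and dynamic programming -/

/-- A table algorithm: from a node `t` of a tree, its bag, a table (rows of type `ι`) from an
earlier traversal, the bag-program at `t` together with the projection atoms, and the tables of the
children of `t`, it computes a table (rows of type `R`) for `t`. -/
abbrev TableAlgorithm (α : Type u) (ι : Type v) (R : Type w) :=
  (T : BagTree α) → (t : T.Node) → Finset α → Finset ι → Program α × Finset α →
    (Fin (T.arity t) → Finset R) → Finset R

section DP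

variable {α : Type u} {ι : Type v} {R : Type w}

/-- Dynamic programming along the tree `T`, bottom-up, with the table algorithm `A` on the
instance `i`, where `inTab` is the table mapping of the input. -/
def dp (A : TableAlgorithm α ι R) (i : Instance α) (T : BagTree α) (inTab : T.Node → Finset ι) :
    T.Node → Finset R :=
  T.isChild_wf.fix fun t rec =>
    A T t (T.bag t) (inTab t) (T.bagProgram i.prog t, i.proj) fun j => rec (T.child t j) ⟨j, rfl⟩

theorem dp_eq (A : TableAlgorithm α ι R) (i : Instance α) (T : BagTree α)
    (inTab : T.Node → Finset ι) (t : T.Node) :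
    dp A i T inTab t = A T t (T.bag t) (inTab t) (T.bagProgram i.prog t, i.proj)
      fun j => dp A i T inTab (T.child t j) :=
  T.isChild_wf.fix_eq _ t

end DP

/-- A row of an algorithm that computes interpretations: the first position is the interpretation
part, the remaining positions (of type `β`) are arbitrary. -/
abbrev Row (α : Type u) (β : Type v) := Finset α × β

/-- A table algorithm for the first traversal. -/
abbrev ConsAlgorithm (α : Type u) (β : Type v) := TableAlgorithm α (Row α β) (Row α β)

section Extensions

variable {α : Type u} {β : Type v} (A : ConsAlgorithm α β) (i : Instance α) (T : BagTree α)

/-- The table mapping obtained by the first traversal, which starts from empty tables. -/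
def consTables : T.Node → Finset (Row α β) := dp A i T fun _ => ∅

/-- The originating rows of the row `r` at `t`: the sequences of rows, one from the table of each
child of `t`, from which (as one-row tables) the algorithm produces a table that contains `r`. -/
def orig (t : T.Node) (r : Row α β) : Finset (Fin (T.arity t) → Row α β) :=
  (Fintype.piFinset fun j => consTables A i T (T.child t j)).filter fun s =>
    r ∈ A T t (T.bag t) ∅ (T.bagProgram i.prog t, i.proj) fun j => {s j}

/-- The originating rows of a table at `t`. -/
def origs (t : T.Node) (ρ : Finset (Row α β)) : Finset (Fin (T.arity t) → Row α β) :=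
  ρ.biUnion (orig A i T t)

/-- `IsExtension A i T t r X`: the set `X` of pairs of a node and a row is an extension below `t`
of the row `r`. -/
inductive IsExtension : T.Node → Row α β → Finset (T.Node × Row α β) → Prop
  | leaf (t : T.Node) (r : Row α β) (ht : T.IsLeaf t) : IsExtension t r {(t, r)}
  | node (t : T.Node) (r : Row α β) (ht : ¬ T.IsLeaf t) (s : Fin (T.arity t) → Row α β)
      (hs : s ∈ orig A i T t r) (X : Fin (T.arity t) → Finset (T.Node × Row α β))
      (hX : ∀ j, IsExtension (T.child t j) (s j) (X j)) :
      IsExtension t r ({(t, r)} ∪ Finset.univ.biUnion X)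

/-- The extensions below `t` of a table. -/
def extensions (t : T.Node) (ρ : Finset (Row α β)) : Set (Finset (T.Node × Row α β)) :=
  {X | ∃ r ∈ ρ, IsExtension A i T t r X}

/-- The family of all extensions: those below the root of the table at the root. -/
def allExtensions : Set (Finset (T.Node × Row α β)) :=
  extensions A i T T.root (consTables A i T T.root)

/-- The satisfiable extensions below `t` of a table: those that are part of an extension at the
root. -/
def satExtensions (t : T.Node) (ρ : Finset (Row α β)) : Set (Finset (T.Node × Row α β)) :=
  {X | X ∈ extensions A i T t ρ ∧ ∃ Y ∈ allExtensions A i T, X ⊆ Y}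

variable {T} in
/-- The local table at `t` of a family of extensions. -/
def localTable (t : T.Node) (E : Set (Finset (T.Node × Row α β))) : Set (Row α β) :=
  {r | ∃ X ∈ E, (t, r) ∈ X}

variable {T} in
/-- The interpretations of a family of extensions. -/
def interpretations (E : Set (Finset (T.Node × Row α β))) : Set (Finset α) :=
  {I | ∃ X ∈ E, I = X.biUnion fun x => x.2.1}

/-- The purged table mapping: at every node, the rows that belong to the local table of the
satisfiable extensions (all such rows are rows of the table computed at this node). -/
def purgedTables (t : T.Node) : Finset (Row α β) :=
  (consTables A i T t).filter fun r =>
    r ∈ localTable t (satExtensions A i T t (consTables A i T t))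

/-- The table algorithm `A` meets the admissibility conditions on the instance `i` and the
decomposition `T`. -/
structure AdmissibleOn : Prop where
  interp_subset_bag : ∀ t, ∀ r ∈ consTables A i T t, r.1 ⊆ T.bag t
  interp_agree : ∀ t, ∀ r ∈ consTables A i T t, ∀ s ∈ orig A i T t r, ∀ j,
    (s j).1 ∩ T.bag (T.child t j) ∩ T.bag t = r.1 ∩ T.bag (T.child t j) ∩ T.bag t
  interp_eq : ∀ t, interpretations (satExtensions A i T t (consTables A i T t)) =
    {I | I ⊆ T.atomsBelow t ∧ IsModel (T.programBelow i.prog t) I ∧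
      ∃ I', IsAnswerSet i.prog I' ∧ I ⊆ I' ∧ I' ⊆ I ∪ (atoms i.prog \ T.atomsBelow t)}
  card_le_one : ∀ t, (t = T.root ∨ T.IsLeaf t) →
    (localTable t (satExtensions A i T t (consTables A i T t))).encard ≤ 1

end Extensions

/-- The table algorithm `A` is admissible for the class `C` of programs: the admissibility
conditions hold for all instances with a program in `C` and all nice tree decompositions of the
primal graph. -/
def Admissible {α : Type u} {β : Type v} (A : ConsAlgorithm α β) (C : Set (Program α)) : Prop :=
  ∀ i : Instance α, i.prog ∈ C → ∀ T : BagTree α,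
    T.IsNiceTreeDecomposition (primalGraph i.prog) → AdmissibleOn A i T

/-! ### Projected counting on the purged tables -/

/-- A row of the projection algorithm: a table and a non-negative integer. -/
abbrev ProjRow (α : Type u) (β : Type v) := Finset (Row α β) × ℕ

section Proj

variable {α : Type u} {β : Type v}

/-- The equivalence classes of rows with the same interpretation part restricted to `P`. -/
def buckets (P : Finset α) (ρ : Finset (Row α β)) : Finset (Finset (Row α β)) :=
  ρ.image fun r => ρ.filter fun r' => r'.1 ∩ P = r.1 ∩ P

/-- The non-empty subsets of the buckets. -/
def subBuckets (P : Finset α) (ρ : Finset (Row α β)) : Finset (Finset (Row α β)) :=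
  (buckets P ρ).biUnion fun B => B.powerset.filter Finset.Nonempty

/-- The stored count of the table `ρ` in `π`. -/
def sipmc (π : Finset (ProjRow α β)) (ρ : Finset (Row α β)) : ℕ :=
  ∑ x ∈ π.filter (fun x => x.1 = ρ), x.2

/-- The stored count of a set `O` of sequences of rows: the product, over the positions, of the
stored counts of the sets of rows of `O` at this position. -/
def sipmcSeq {l : ℕ} (π : Fin l → Finset (ProjRow α β)) (O : Finset (Fin l → Row α β)) : ℕ :=
  ∏ j, sipmc (π j) (O.image fun s => s j)

variable (A : ConsAlgorithm α β) (i : Instance α) (T : BagTree α)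

/-- The projected count of `ρ` at `t`, by inclusion-exclusion on the stored counts of origins. -/
def pmc (t : T.Node) (π : Fin (T.arity t) → Finset (ProjRow α β)) (ρ : Finset (Row α β)) : ℤ :=
  ∑ O ∈ (origs A i T t ρ).powerset.filter Finset.Nonempty,
    (-1) ^ (O.card - 1) * (sipmcSeq π O : ℤ)

/-- The intersection projected count of `ρ` at `t`. -/
def ipmc (t : T.Node) (π : Fin (T.arity t) → Finset (ProjRow α β)) (ρ : Finset (Row α β)) : ℕ :=
  if T.IsLeaf t then 1
  else (pmc A i T t π ρ + ∑ φ ∈ (ρ.ssubsets.filter Finset.Nonempty).attach,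
    (-1) ^ φ.1.card * (ipmc t π φ.1 : ℤ)).natAbs
termination_by ρ.card
decreasing_by
  exact Finset.card_lt_card (Finset.mem_ssubsets.1 (Finset.mem_filter.1 φ.2).1)

end Proj

section MDP

variable {α : Type u} {β : Type v} (A : ConsAlgorithm α β) (i : Instance α) (T : BagTree α)

/-- The table algorithm for projected counting. Origins refer to the first traversal of `A` on the
instance `i`; the table of the earlier traversal is the purged one. -/
def proj : TableAlgorithm α (Row α β) (ProjRow α β) :=
  fun T t _ ν q π => (subBuckets q.2 ν).image fun ρ => (ρ, ipmc A i T t π ρ)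

/-- The table mapping returned by dynamic programming with the projection algorithm on the purged
tabled tree decomposition. -/
def projTables : T.Node → Finset (ProjRow α β) := dp (proj A i) i T (purgedTables A i T)

/-- The whole procedure: decompose the primal graph, run `A`, purge, run the projection algorithm,
and read off the count stored at the root. -/
def mdp (decompose : Program α → BagTree α) : ℕ :=
  ∑ x ∈ projTables A i (decompose i.prog) (decompose i.prog).root, x.2

end MDP

end PAS

end

/-!
Call the traces on `P` of the satisfiable extensions of a row `u` at `t` the projected
interpretations of `u`. The invariant of the second pass is that the stored count of a set `ρ` of
rows at `t` is the number of projected interpretations common to all rows in `ρ`.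

By the running intersection property, a projected interpretation of a row with trace `Q` on `P` is
obtained by adding to `Q` one projected interpretation for each row of an origin, and these parts
can be recovered by restriction to the atoms below each child. Hence, within a bucket, the
projected interpretations are the union of injective images of boxes indexed by the origins, and
the size of an intersection of boxes is a product of stored counts: inclusion-exclusion over the
origins gives `pmc`. Inclusion-exclusion over the subsets of `ρ`, solved for its top term, then
gives `ipmc`. At the root a single row is left, whose projected interpretations are the traces of
the answer sets.
-/

noncomputable section

namespace PAS

universe u v w

section InclusionExclusion

variable {ι : Type*} {κ : Type u} {γ : Type v} {δ : Type w} [DecidableEq γ] [DecidableEq δ]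

/-- The intersection of a finite family of finite sets, with the convention that the empty family
has empty intersection. -/
def biInter (ρ : Finset κ) (S : κ → Finset γ) : Finset γ :=
  (ρ.biUnion S).filter fun x => ∀ r ∈ ρ, x ∈ S r

theorem mem_biInter {ρ : Finset κ} {S : κ → Finset γ} {x : γ} :
    x ∈ biInter ρ S ↔ ρ.Nonempty ∧ ∀ r ∈ ρ, x ∈ S r := by
  simp only [biInter, Finset.mem_filter, Finset.mem_biUnion, and_congr_left_iff]
  exact fun h => ⟨fun ⟨r, hr, _⟩ => ⟨r, hr⟩, fun ⟨r, hr⟩ => ⟨r, hr, h r hr⟩⟩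

theorem biInter_congr {ρ : Finset κ} {S S' : κ → Finset γ} (h : ∀ r ∈ ρ, S r = S' r) :
    biInter ρ S = biInter ρ S' := by
  ext x
  simp +contextual only [mem_biInter, h]

theorem biInter_const {ρ : Finset κ} (hρ : ρ.Nonempty) (s : Finset γ) :
    biInter ρ (fun _ => s) = s := by
  ext x
  simp only [mem_biInter, hρ, true_and]
  exact ⟨fun h => h _ hρ.choose_spec, fun h _ _ => h⟩

theorem biInter_eq_biUnion {ρ : Finset κ} (hρ : ρ.card ≤ 1) (S : κ → Finset γ) :
    biInter ρ S = ρ.biUnion S := by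
  refine Finset.filter_true_of_mem fun x hx r hr => ?_
  obtain ⟨r', hr', hx⟩ := Finset.mem_biUnion.1 hx
  rwa [Finset.card_le_one.1 hρ r hr r' hr']

theorem biInter_image {O : Finset κ} {S : κ → Finset γ} {Φ : γ → δ}
    (hΦ : Set.InjOn Φ (O.biUnion S)) :
    biInter O (fun s => (S s).image Φ) = (biInter O S).image Φ := by
  ext y
  simp only [mem_biInter, Finset.mem_image]
  constructor
  · rintro ⟨⟨s₀, hs₀⟩, hy⟩
    obtain ⟨x, hx, rfl⟩ := hy s₀ hs₀
    refine ⟨x, ⟨⟨s₀, hs₀⟩, fun s hs => ?_⟩, rfl⟩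
    obtain ⟨x', hx', hxx'⟩ := hy s hs
    rwa [← hΦ (Finset.mem_biUnion.2 ⟨s, hs, hx'⟩) (Finset.mem_biUnion.2 ⟨s₀, hs₀, hx⟩) hxx']
  · rintro ⟨x, ⟨hO, hx⟩, rfl⟩
    exact ⟨hO, fun s hs => ⟨x, hx s hs, rfl⟩⟩

theorem biInter_piFinset [Fintype ι] [DecidableEq ι] [DecidableEq κ] {O : Finset (ι → κ)}
    (hO : O.Nonempty) (S : ι → κ → Finset γ) :
    biInter O (fun s => Fintype.piFinset fun j => S j (s j)) =
      Fintype.piFinset fun j => biInter (O.image fun s => s j) (S j) := by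
  ext K
  simp only [mem_biInter, Fintype.mem_piFinset, Finset.forall_mem_image, hO, hO.image, true_and]
  exact ⟨fun h j s hs => h s hs j, fun h s hs j => h j hs⟩

theorem card_biUnion_eq_sum_card_biInter (ρ : Finset κ) (S : κ → Finset γ) :
    ((ρ.biUnion S).card : ℤ) = ∑ φ ∈ ρ.powerset.filter Finset.Nonempty,
      (-1) ^ (φ.card - 1) * ((biInter φ S).card : ℤ) := by
  rw [Finset.inclusion_exclusion_card_biUnion, Finset.univ_eq_attach,
    ← Finset.sum_attach (ρ.powerset.filter Finset.Nonempty)]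
  refine Finset.sum_congr rfl fun φ _ => ?_
  have hφ : φ.1.Nonempty := (Finset.mem_filter.1 φ.2).2
  have hsign : (-1 : ℤ) ^ (φ.1.card + 1) = (-1) ^ (φ.1.card - 1) := by
    rw [← Nat.sub_add_cancel hφ.card_pos, Nat.add_sub_cancel, pow_add, pow_add]
    norm_num
  have hinter : φ.1.inf' hφ S = biInter φ.1 S := by
    ext x
    simp only [Finset.mem_inf', mem_biInter, hφ, true_and]
  rw [hsign, hinter]

theorem powerset_filter_nonempty_eq_insert [DecidableEq κ] {ρ : Finset κ} (hρ : ρ.Nonempty) :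
    ρ.powerset.filter Finset.Nonempty = insert ρ (ρ.ssubsets.filter Finset.Nonempty) := by
  ext φ
  simp only [Finset.mem_filter, Finset.mem_powerset, Finset.mem_insert, Finset.mem_ssubsets,
    subset_iff_ssubset_or_eq]
  grind

theorem card_biInter_eq_natAbs [DecidableEq κ] {ρ : Finset κ} (hρ : ρ.Nonempty)
    (S : κ → Finset γ) :
    (biInter ρ S).card = (((ρ.biUnion S).card : ℤ) +
      ∑ φ ∈ ρ.ssubsets.filter Finset.Nonempty,
        (-1) ^ φ.card * ((biInter φ S).card : ℤ)).natAbs := by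
  have hcancel : ∀ φ ∈ ρ.ssubsets.filter Finset.Nonempty,
      (-1 : ℤ) ^ (φ.card - 1) * (biInter φ S).card + (-1) ^ φ.card * (biInter φ S).card = 0 := by
    intro φ hφ
    obtain ⟨n, hn⟩ := Nat.exists_eq_succ_of_ne_zero (Finset.mem_filter.1 hφ).2.card_pos.ne'
    rw [hn, Nat.succ_sub_one, pow_succ]
    ring
  have hρ_notMem : ρ ∉ ρ.ssubsets.filter Finset.Nonempty := by simp
  rw [card_biUnion_eq_sum_card_biInter, powerset_filter_nonempty_eq_insert hρ,
    Finset.sum_insert hρ_notMem, add_assoc, ← Finset.sum_add_distrib,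
    Finset.sum_eq_zero hcancel, add_zero, Int.natAbs_mul, Int.natAbs_pow]
  simp

end InclusionExclusion

/-- The union of a set `Q` and a family of sets `K`: it assembles the interpretation at a node from
the interpretation part of a row at this node and the interpretations at the children. -/
def glue {α : Type*} {ι : Type*} [Fintype ι] (Q : Finset α) (K : ι → Finset α) : Finset α :=
  Q ∪ Finset.univ.biUnion K

theorem mem_glue {α : Type*} {ι : Type*} [Fintype ι] {Q : Finset α} {K : ι → Finset α} {a : α} :
    a ∈ glue Q K ↔ a ∈ Q ∨ ∃ j, a ∈ K j := by
  simp [glue]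

theorem glue_inter {α : Type*} {ι : Type*} [Fintype ι] (Q : Finset α) (K : ι → Finset α)
    (P : Finset α) : glue Q K ∩ P = glue (Q ∩ P) fun j => K j ∩ P := by
  rw [glue, glue, Finset.union_inter_distrib_right, Finset.biUnion_inter]

namespace BagTree

variable {α : Type u} {T : BagTree α}

theorem mem_below {t s : T.Node} :
    s ∈ T.below t ↔ Relation.ReflTransGen (fun a b => T.IsChild b a) t s := by
  simp [below]

theorem self_mem_below (t : T.Node) : t ∈ T.below t := mem_below.2 .refl

theorem below_child_subset (t : T.Node) (j : Fin (T.arity t)) :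
    T.below (T.child t j) ⊆ T.below t :=
  fun _ hs => mem_below.2 (.head ⟨j, rfl⟩ (mem_below.1 hs))

theorem IsChild.parent_unique {a b c : T.Node} (ha : T.IsChild c a) (hb : T.IsChild c b) :
    a = b := by
  obtain ⟨i, hi⟩ := ha
  obtain ⟨j, hj⟩ := hb
  exact congrArg Sigma.fst (@T.child_injective ⟨a, i⟩ ⟨b, j⟩ (hi.symm.trans hj))

theorem IsChild.mem_below {p s t : T.Node} (h : T.IsChild s p) (hp : p ∈ T.below t) :
    s ∈ T.below t :=
  BagTree.mem_below.2 (.tail (BagTree.mem_below.1 hp) h)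

theorem IsChild.parent_mem_below {p s t : T.Node} (h : T.IsChild s p) (hs : s ∈ T.below t)
    (hne : s ≠ t) : p ∈ T.below t := by
  rcases (BagTree.mem_below.1 hs).cases_tail with rfl | ⟨q, hq, hsq⟩
  · exact absurd rfl hne
  · rw [h.parent_unique hsq]
    exact BagTree.mem_below.2 hq

theorem notMem_below_child (t : T.Node) (j : Fin (T.arity t)) : t ∉ T.below (T.child t j) := by
  intro h
  have hcycle : Relation.TransGen T.IsChild t t :=
    Relation.transGen_swap.1 (.head' ⟨j, rfl⟩ (mem_below.1 h))
  exact T.isChild_wf.transGen.irrefl.irrefl t hcycle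

theorem disjoint_below_child {t : T.Node} {j k : Fin (T.arity t)} (hjk : j ≠ k) :
    Disjoint (T.below (T.child t j)) (T.below (T.child t k)) := by
  rw [Finset.disjoint_left]
  intro s hj
  induction mem_below.1 hj with
  | refl =>
    intro hk
    have hne : T.child t j ≠ T.child t k := fun h =>
      hjk (by simpa using @T.child_injective ⟨t, j⟩ ⟨t, k⟩ h)
    exact notMem_below_child t k (IsChild.parent_mem_below ⟨j, rfl⟩ hk hne)
  | @tail b c hb hc ih =>
    intro hk
    by_cases hck : c = T.child t k
    · obtain rfl : b = t := hc.parent_unique ⟨k, hck⟩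
      exact notMem_below_child b j (mem_below.2 hb)
    · exact ih (mem_below.2 hb) (hc.parent_mem_below hk hck)

theorem IsChild.adj {a b : T.Node} (h : T.IsChild b a) : T.graph.Adj a b := by
  refine (SimpleGraph.fromRel_adj _ a b).2 ⟨?_, Or.inl h⟩
  rintro rfl
  exact T.isChild_wf.irrefl.irrefl a h

theorem graph_preconnected (T : BagTree α) : T.graph.Preconnected := by
  have hroot : ∀ t, T.graph.Reachable T.root t := fun t => by
    induction T.reachable t with
    | refl => exact .refl _
    | tail _ hbc ih => exact ih.trans (IsChild.adj hbc).reachable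
  exact fun s t => (hroot s).symm.trans (hroot t)

theorem mem_support_of_leaves_below_child {t x y : T.Node} {j : Fin (T.arity t)}
    (q : T.graph.Walk x y) (hx : x ∈ T.below (T.child t j)) (hy : y ∉ T.below (T.child t j)) :
    T.child t j ∈ q.support ∧ t ∈ q.support := by
  induction q with
  | nil => exact absurd hx hy
  | @cons a b c hadj q ih =>
    by_cases hb : b ∈ T.below (T.child t j)
    · exact (ih hb hy).imp (List.mem_cons_of_mem _) (List.mem_cons_of_mem _)
    · rcases ((SimpleGraph.fromRel_adj _ a b).1 hadj).2 with hba | hab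
      · exact absurd (hba.mem_below hx) hb
      · obtain rfl : a = T.child t j := of_not_not fun ha => hb (hab.parent_mem_below hx ha)
        obtain rfl : b = t := hab.parent_unique ⟨j, rfl⟩
        simp

theorem mem_atomsBelow {t : T.Node} {a : α} :
    a ∈ T.atomsBelow t ↔ ∃ s ∈ T.below t, a ∈ T.bag s := Finset.mem_biUnion

theorem bag_subset_atomsBelow (t : T.Node) : T.bag t ⊆ T.atomsBelow t :=
  Finset.subset_biUnion_of_mem T.bag (self_mem_below t)

theorem atomsBelow_child_subset (t : T.Node) (j : Fin (T.arity t)) :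
    T.atomsBelow (T.child t j) ⊆ T.atomsBelow t :=
  Finset.biUnion_subset_biUnion_of_subset_left T.bag (below_child_subset t j)

theorem IsTreeDecomposition.coe_atomsBelow_root {G : (⊤ : SimpleGraph α).Subgraph}
    (hT : T.IsTreeDecomposition G) : (T.atomsBelow T.root : Set α) = G.verts := by
  rw [← hT.bags_cover]
  ext a
  simp only [Finset.mem_coe, mem_atomsBelow, Set.mem_ofPred_eq]
  exact ⟨fun ⟨s, _, hs⟩ => ⟨s, hs⟩, fun ⟨s, hs⟩ => ⟨s, mem_below.2 (T.reachable s), hs⟩⟩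

theorem programBelow_subset (p : Program α) (t : T.Node) : T.programBelow p t ⊆ p :=
  Finset.biUnion_subset.2 fun _ _ => Finset.filter_subset _ _

/-- The running intersection property: an atom of two bags belongs to all bags on the path between
them. This is the third condition on a tree decomposition, which involves no graph. -/
def RunningIntersection (T : BagTree α) : Prop :=
  ∀ (r s t : T.Node) (q : T.graph.Walk r t), q.IsPath → s ∈ q.support →
    T.bag r ∩ T.bag t ⊆ T.bag s

namespace RunningIntersection

theorem mem_bag_of_separated (hT : T.RunningIntersection) {t x y : T.Node} {j : Fin (T.arity t)}
    {a : α} (hx : x ∈ T.below (T.child t j)) (hy : y ∉ T.below (T.child t j)) (hax : a ∈ T.bag x)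
    (hay : a ∈ T.bag y) : a ∈ T.bag (T.child t j) ∧ a ∈ T.bag t := by
  obtain ⟨q, hq⟩ := (T.graph_preconnected x y).exists_isPath
  have ha : a ∈ T.bag x ∩ T.bag y := Finset.mem_inter.2 ⟨hax, hay⟩
  exact (mem_support_of_leaves_below_child q hx hy).imp (fun h => hT x _ y q hq h ha)
    fun h => hT x _ y q hq h ha

theorem mem_bag_child (hT : T.RunningIntersection) {t : T.Node} {j : Fin (T.arity t)} {a : α}
    (ha : a ∈ T.atomsBelow (T.child t j)) (hat : a ∈ T.bag t) : a ∈ T.bag (T.child t j) := by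
  obtain ⟨s, hs, has⟩ := mem_atomsBelow.1 ha
  exact (hT.mem_bag_of_separated hs (notMem_below_child t j) has hat).1

theorem mem_bag_of_mem_children (hT : T.RunningIntersection) {t : T.Node}
    {j k : Fin (T.arity t)} (hjk : j ≠ k) {a : α} (hj : a ∈ T.atomsBelow (T.child t j))
    (hk : a ∈ T.atomsBelow (T.child t k)) : a ∈ T.bag t := by
  obtain ⟨x, hx, hax⟩ := mem_atomsBelow.1 hj
  obtain ⟨y, hy, hay⟩ := mem_atomsBelow.1 hk
  have hyj := Finset.disjoint_right.1 (disjoint_below_child hjk) hy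
  exact (hT.mem_bag_of_separated hx hyj hax hay).2

theorem glue_inter_atomsBelow_child (hT : T.RunningIntersection) {t : T.Node} {Q : Finset α}
    {K : Fin (T.arity t) → Finset α} (hQ : Q ⊆ T.bag t)
    (hK : ∀ j, K j ⊆ T.atomsBelow (T.child t j))
    (hagree : ∀ j, K j ∩ T.bag t = Q ∩ T.bag (T.child t j)) (j : Fin (T.arity t)) :
    glue Q K ∩ T.atomsBelow (T.child t j) = K j := by
  have hQK : Q ∩ T.atomsBelow (T.child t j) ⊆ K j := fun a ha => by
    obtain ⟨haQ, ha⟩ := Finset.mem_inter.1 ha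
    have haK : a ∈ K j ∩ T.bag t := by
      rw [hagree]
      exact Finset.mem_inter.2 ⟨haQ, hT.mem_bag_child ha (hQ haQ)⟩
    exact (Finset.mem_inter.1 haK).1
  refine subset_antisymm (fun a ha => ?_) fun a ha =>
    Finset.mem_inter.2 ⟨mem_glue.2 (Or.inr ⟨j, ha⟩), hK j ha⟩
  obtain ⟨haglue, ha⟩ := Finset.mem_inter.1 ha
  rcases mem_glue.1 haglue with haQ | ⟨k, hak⟩
  · exact hQK (Finset.mem_inter.2 ⟨haQ, ha⟩)
  · obtain rfl | hkj := eq_or_ne k j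
    · exact hak
    · have hat := hT.mem_bag_of_mem_children hkj (hK k hak) ha
      have haQ : a ∈ Q ∩ T.bag (T.child t k) := hagree k ▸ Finset.mem_inter.2 ⟨hak, hat⟩
      exact hQK (Finset.mem_inter.2 ⟨(Finset.mem_inter.1 haQ).1, ha⟩)

end RunningIntersection

end BagTree

section AnswerSets

variable {α : Type u} {p : Program α} {I : Finset α}

theorem IsAnswerSet.isModel (h : IsAnswerSet p I) : IsModel p I := by
  intro r hr
  by_cases hneg : r.neg ∩ I = ∅
  · have hmem : r.positive ∈ reduct p I :=
      Finset.mem_image.2 ⟨r, Finset.mem_filter.2 ⟨hr, hneg⟩, rfl⟩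
    refine (h.1 _ hmem).imp_left fun hhead => ?_
    exact hhead.mono (Finset.inter_subset_inter_right
      (Finset.union_subset_union_right (Finset.empty_subset _)))
  · left
    exact (Finset.nonempty_iff_ne_empty.2 hneg).mono
      (Finset.inter_subset_inter_right Finset.subset_union_right)

theorem IsModel.inter_atoms {J : Finset α} (h : IsModel (reduct p J) I) :
    IsModel (reduct p J) (I ∩ atoms p) := by
  intro r hr
  obtain ⟨r', hr', rfl⟩ := Finset.mem_image.1 hr
  have hatoms : r'.atoms ⊆ atoms p :=
    Finset.subset_biUnion_of_mem Rule.atoms (Finset.mem_filter.1 hr').1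
  refine (h _ hr).imp (fun ⟨a, ha⟩ => ⟨a, ?_⟩) fun hpos =>
    hpos.mono (Finset.sdiff_subset_sdiff subset_rfl Finset.inter_subset_left)
  simp only [Rule.positive, Finset.union_empty, Finset.mem_inter] at ha ⊢
  exact ⟨ha.1, ha.2, hatoms (by simp [Rule.atoms, ha.1])⟩

theorem IsAnswerSet.subset_atoms (h : IsAnswerSet p I) : I ⊆ atoms p := by
  by_contra hsub
  have hlt : I ∩ atoms p ⊂ I :=
    Finset.inter_subset_left.ssubset_of_ne fun he => hsub (Finset.inter_eq_left.1 he)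
  exact h.2 _ hlt h.1.inter_atoms

theorem projectedCount_eq_ncard (i : Instance α) :
    projectedCount i = ((· ∩ i.proj) '' {I | IsAnswerSet i.prog I}).ncard := by
  rw [projectedCount, ← Set.ncard_coe_finset]
  congr 1
  ext K
  simp only [Finset.coe_filter, Finset.mem_powerset, Set.mem_ofPred_eq, Set.mem_image]
  constructor
  · rintro ⟨hK, J, hJ, hans⟩
    refine ⟨K ∪ J, hans, ?_⟩
    have hJP : Disjoint J i.proj := (Finset.subset_sdiff.1 hJ).2
    rw [Finset.union_inter_distrib_right, Finset.inter_eq_left.2 hK,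
      Finset.disjoint_iff_inter_eq_empty.1 hJP, Finset.union_empty]
  · rintro ⟨I, hans, rfl⟩
    refine ⟨Finset.inter_subset_right, I \ i.proj,
      Finset.sdiff_subset_sdiff hans.subset_atoms subset_rfl, ?_⟩
    rwa [Finset.union_comm, Finset.sdiff_union_inter]

end AnswerSets

section Extensions

variable {α : Type u} {β : Type v} {A : ConsAlgorithm α β} {i : Instance α} {T : BagTree α}

/-- The interpretation of a set of pairs of a node and a row. -/
def interp (X : Finset (T.Node × Row α β)) : Finset α := X.biUnion fun x => x.2.1

theorem interp_singleton (t : T.Node) (r : Row α β) : interp {(t, r)} = r.1 :=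
  Finset.singleton_biUnion

theorem interp_union_biUnion (t : T.Node) (r : Row α β) {l : ℕ}
    (X : Fin l → Finset (T.Node × Row α β)) :
    interp ({(t, r)} ∪ Finset.univ.biUnion X) = glue r.1 fun j => interp (X j) := by
  rw [interp, Finset.union_biUnion, Finset.singleton_biUnion, Finset.biUnion_biUnion]
  rfl

theorem mem_consTables_of_mem_orig {t : T.Node} {r : Row α β} {s : Fin (T.arity t) → Row α β}
    (hs : s ∈ orig A i T t r) (j : Fin (T.arity t)) : s j ∈ consTables A i T (T.child t j) :=
  Fintype.mem_piFinset.1 (Finset.mem_filter.1 hs).1 j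

theorem isExtension_iff_of_isLeaf {t : T.Node} (ht : T.IsLeaf t) {r : Row α β}
    {X : Finset (T.Node × Row α β)} : IsExtension A i T t r X ↔ X = {(t, r)} := by
  constructor
  · rintro (_ | ⟨_, _, hnt⟩)
    · rfl
    · exact absurd ht hnt
  · rintro rfl
    exact .leaf t r ht

theorem isExtension_iff_of_not_isLeaf {t : T.Node} (ht : ¬ T.IsLeaf t) {r : Row α β}
    {X : Finset (T.Node × Row α β)} :
    IsExtension A i T t r X ↔ ∃ s ∈ orig A i T t r, ∃ Z : Fin (T.arity t) → _,
      (∀ j, IsExtension A i T (T.child t j) (s j) (Z j)) ∧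
        X = {(t, r)} ∪ Finset.univ.biUnion Z := by
  constructor
  · rintro (⟨_, _, hleaf⟩ | ⟨_, _, _, s, hs, Z, hZ⟩)
    · exact absurd hleaf ht
    · exact ⟨s, hs, Z, hZ, rfl⟩
  · rintro ⟨s, hs, Z, hZ, rfl⟩
    exact .node t r ht s hs Z hZ

theorem IsExtension.self_mem {t : T.Node} {r : Row α β} {X : Finset (T.Node × Row α β)}
    (h : IsExtension A i T t r X) : (t, r) ∈ X := by
  cases h <;> simp

theorem IsExtension.exists_superset {t t' : T.Node} {r r' : Row α β}
    {X Y : Finset (T.Node × Row α β)} (hY : IsExtension A i T t r Y) (hmem : (t', r') ∈ Y)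
    (hX : IsExtension A i T t' r' X) : ∃ Y', IsExtension A i T t r Y' ∧ X ⊆ Y' := by
  induction hY with
  | leaf t r ht =>
    obtain ⟨rfl, rfl⟩ := Prod.mk.inj (Finset.mem_singleton.1 hmem)
    exact ⟨X, hX, subset_rfl⟩
  | node t r ht s hs Z hZ ih =>
    rcases Finset.mem_union.1 hmem with hself | hbelow
    · obtain ⟨rfl, rfl⟩ := Prod.mk.inj (Finset.mem_singleton.1 hself)
      exact ⟨X, hX, subset_rfl⟩
    · obtain ⟨j, _, hj⟩ := Finset.mem_biUnion.1 hbelow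
      obtain ⟨Z', hZ', hsub⟩ := ih j hj
      refine ⟨_, .node t r ht s hs (Function.update Z j Z') fun k => ?_, ?_⟩
      · obtain rfl | hkj := eq_or_ne k j
        · simpa only [Function.update_self] using hZ'
        · simpa only [Function.update_of_ne hkj] using hZ k
      · have hj_sub := Finset.subset_biUnion_of_mem (Function.update Z j Z') (Finset.mem_univ j)
        rw [Function.update_self] at hj_sub
        exact (hsub.trans hj_sub).trans Finset.subset_union_right

theorem mem_satExtensions_singleton {t : T.Node} {r : Row α β} {X : Finset (T.Node × Row α β)} :
    X ∈ satExtensions A i T t {r} ↔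
      IsExtension A i T t r X ∧ ∃ Y ∈ allExtensions A i T, X ⊆ Y := by
  simp [satExtensions, extensions]

theorem mem_satExtensions {t : T.Node} {ρ : Finset (Row α β)} {X : Finset (T.Node × Row α β)} :
    X ∈ satExtensions A i T t ρ ↔ ∃ r ∈ ρ, X ∈ satExtensions A i T t {r} := by
  simp only [mem_satExtensions_singleton]
  exact ⟨fun ⟨⟨r, hr, hX⟩, hY⟩ => ⟨r, hr, hX, hY⟩, fun ⟨r, hr, hX, hY⟩ => ⟨⟨r, hr, hX⟩, hY⟩⟩

theorem purgedTables_subset_consTables (t : T.Node) :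
    purgedTables A i T t ⊆ consTables A i T t :=
  Finset.filter_subset _ _

theorem mem_purgedTables_of_mem_satExtensions {t : T.Node} {r : Row α β}
    {X : Finset (T.Node × Row α β)} (hr : r ∈ consTables A i T t)
    (hX : X ∈ satExtensions A i T t {r}) : r ∈ purgedTables A i T t :=
  Finset.mem_filter.2 ⟨hr, X, mem_satExtensions.2 ⟨r, hr, hX⟩,
    (mem_satExtensions_singleton.1 hX).1.self_mem⟩

/- If `(t, r)` occurs in an extension `Y` at the root, then the part of `Y` below `t` may be
replaced by any other extension of `r`. -/
theorem mem_satExtensions_iff_isExtension {t : T.Node} {r : Row α β}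
    {X : Finset (T.Node × Row α β)} (hr : r ∈ purgedTables A i T t) :
    X ∈ satExtensions A i T t {r} ↔ IsExtension A i T t r X := by
  rw [mem_satExtensions_singleton, and_iff_left_iff_imp]
  intro hX
  obtain ⟨Z, ⟨_, Y, ⟨r', hr', hY⟩, hZY⟩, hrZ⟩ := (Finset.mem_filter.1 hr).2
  obtain ⟨Y', hY', hsub⟩ := hY.exists_superset (hZY hrZ) hX
  exact ⟨Y', ⟨r', hr', hY'⟩, hsub⟩

theorem mem_satExtensions_of_subset {t t' : T.Node} {r r' : Row α β}
    {X X' : Finset (T.Node × Row α β)} (hX : IsExtension A i T t r X)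
    (hX' : X' ∈ satExtensions A i T t' {r'}) (hsub : X ⊆ X') :
    X ∈ satExtensions A i T t {r} := by
  obtain ⟨-, Y, hY, hX'Y⟩ := mem_satExtensions_singleton.1 hX'
  exact mem_satExtensions_singleton.2 ⟨hX, Y, hY, hsub.trans hX'Y⟩

theorem card_purgedTables_le_one {t : T.Node}
    (h : (localTable t (satExtensions A i T t (consTables A i T t))).encard ≤ 1) :
    (purgedTables A i T t).card ≤ 1 :=
  Finset.card_le_one.2 fun r hr r' hr' =>
    Set.encard_le_one_iff.1 h r r' (Finset.mem_filter.1 hr).2 (Finset.mem_filter.1 hr').2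

end Extensions

section ProjectedInterpretations

variable {α : Type u} {β : Type v} (A : ConsAlgorithm α β) (i : Instance α) (T : BagTree α)

/-- The projected interpretations of the row `r` at `t`: the traces on the projection atoms of the
interpretations of the satisfiable extensions of `r`. -/
def projInterps (t : T.Node) (r : Row α β) : Finset (Finset α) :=
  i.proj.powerset.filter fun K => ∃ X ∈ satExtensions A i T t {r}, interp X ∩ i.proj = K

/-- The box of all choices of one projected interpretation for each row of the sequence `s` of rows
at the children of `t`. -/
def childInterps (t : T.Node) (s : Fin (T.arity t) → Row α β) :
    Finset (Fin (T.arity t) → Finset α) :=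
  Fintype.piFinset fun j => projInterps A i T (T.child t j) (s j)

variable {A i T}

theorem mem_projInterps {t : T.Node} {r : Row α β} {K : Finset α} :
    K ∈ projInterps A i T t r ↔ ∃ X ∈ satExtensions A i T t {r}, interp X ∩ i.proj = K := by
  simp only [projInterps, Finset.mem_filter, Finset.mem_powerset, and_iff_right_iff_imp]
  rintro ⟨X, _, rfl⟩
  exact Finset.inter_subset_right

theorem mem_purgedTables_of_mem_projInterps {t : T.Node} {r : Row α β} {K : Finset α}
    (hr : r ∈ consTables A i T t) (hK : K ∈ projInterps A i T t r) :
    r ∈ purgedTables A i T t := by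
  obtain ⟨X, hX, _⟩ := mem_projInterps.1 hK
  exact mem_purgedTables_of_mem_satExtensions hr hX

theorem coe_biUnion_projInterps_purgedTables (t : T.Node) :
    ((purgedTables A i T t).biUnion (projInterps A i T t) : Set (Finset α)) =
      (· ∩ i.proj) '' interpretations (satExtensions A i T t (consTables A i T t)) := by
  ext K
  simp only [Finset.mem_coe, Finset.mem_biUnion, Set.mem_image]
  constructor
  · rintro ⟨r, hr, hK⟩
    obtain ⟨X, hX, rfl⟩ := mem_projInterps.1 hK
    exact ⟨_, ⟨X, mem_satExtensions.2 ⟨r, purgedTables_subset_consTables t hr, hX⟩, rfl⟩, rfl⟩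
  · rintro ⟨_, ⟨X, hX, rfl⟩, rfl⟩
    obtain ⟨r, hr, hX⟩ := mem_satExtensions.1 hX
    exact ⟨r, mem_purgedTables_of_mem_satExtensions hr hX, mem_projInterps.2 ⟨X, hX, rfl⟩⟩

theorem projInterps_of_isLeaf {t : T.Node} (ht : T.IsLeaf t) {r : Row α β}
    (hr : r ∈ purgedTables A i T t) : projInterps A i T t r = {r.1 ∩ i.proj} := by
  ext K
  simp only [mem_projInterps, mem_satExtensions_iff_isExtension hr, isExtension_iff_of_isLeaf ht,
    exists_eq_left, interp_singleton, Finset.mem_singleton, eq_comm]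

theorem projInterps_of_not_isLeaf {t : T.Node} (ht : ¬ T.IsLeaf t) {r : Row α β}
    (hr : r ∈ purgedTables A i T t) :
    projInterps A i T t r = (orig A i T t r).biUnion fun s =>
      (childInterps A i T t s).image (glue (r.1 ∩ i.proj)) := by
  ext K
  simp only [Finset.mem_biUnion, Finset.mem_image, childInterps, Fintype.mem_piFinset]
  rw [mem_projInterps]
  constructor
  · rintro ⟨X, hX, rfl⟩
    obtain ⟨s, hs, Z, hZ, rfl⟩ :=
      (isExtension_iff_of_not_isLeaf ht).1 (mem_satExtensions_singleton.1 hX).1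
    refine ⟨s, hs, fun j => interp (Z j) ∩ i.proj, fun j => mem_projInterps.2 ⟨Z j, ?_, rfl⟩, ?_⟩
    · exact mem_satExtensions_of_subset (hZ j) hX
        ((Finset.subset_biUnion_of_mem Z (Finset.mem_univ j)).trans Finset.subset_union_right)
    · rw [interp_union_biUnion, glue_inter]
  · rintro ⟨s, hs, K', hK', rfl⟩
    choose Z hZ hZK' using fun j => mem_projInterps.1 (hK' j)
    refine ⟨{(t, r)} ∪ Finset.univ.biUnion Z, (mem_satExtensions_iff_isExtension hr).2 ?_, ?_⟩
    · exact .node t r ht s hs Z fun j => (mem_satExtensions_singleton.1 (hZ j)).1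
    · rw [interp_union_biUnion, glue_inter, funext hZK']

theorem biUnion_projInterps_of_not_isLeaf {t : T.Node} (ht : ¬ T.IsLeaf t)
    {ρ : Finset (Row α β)} {Q : Finset α} (hρ : ρ ⊆ purgedTables A i T t)
    (hQ : ∀ r ∈ ρ, r.1 ∩ i.proj = Q) :
    ρ.biUnion (projInterps A i T t) = (origs A i T t ρ).biUnion fun s =>
      (childInterps A i T t s).image (glue Q) := by
  rw [origs, Finset.biUnion_biUnion]
  exact Finset.biUnion_congr rfl fun r hr => by
    rw [projInterps_of_not_isLeaf ht (hρ hr), hQ r hr]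

end ProjectedInterpretations

section Coherence

variable {α : Type u} {β : Type v} {A : ConsAlgorithm α β} {i : Instance α} {T : BagTree α}

/-- The conditions (1) and (2) of admissibility: the interpretation part of a row lies in the bag
and agrees with those of its origins on the common atoms of the two bags. They involve neither
answer sets nor satisfiability, and control how interpretations of extensions fit together. -/
structure IsCoherent (A : ConsAlgorithm α β) (i : Instance α) (T : BagTree α) : Prop where
  interp_subset_bag : ∀ t, ∀ r ∈ consTables A i T t, r.1 ⊆ T.bag t
  interp_agree : ∀ t, ∀ r ∈ consTables A i T t, ∀ s ∈ orig A i T t r, ∀ j,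
    (s j).1 ∩ T.bag (T.child t j) ∩ T.bag t = r.1 ∩ T.bag (T.child t j) ∩ T.bag t

theorem AdmissibleOn.isCoherent (h : AdmissibleOn A i T) : IsCoherent A i T :=
  ⟨h.interp_subset_bag, h.interp_agree⟩

theorem IsCoherent.inter_bag_eq (hA : IsCoherent A i T) (hT : T.RunningIntersection)
    {t : T.Node} {r : Row α β} (hr : r ∈ consTables A i T t) {s : Fin (T.arity t) → Row α β}
    (hs : s ∈ orig A i T t r) {j : Fin (T.arity t)} {K : Finset α}
    (hK : K ⊆ T.atomsBelow (T.child t j)) (hKs : K ∩ T.bag (T.child t j) = (s j).1) :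
    K ∩ T.bag t = r.1 ∩ T.bag (T.child t j) := by
  have hKt : K ∩ T.bag t ⊆ T.bag (T.child t j) := fun a ha =>
    hT.mem_bag_child (hK (Finset.mem_inter.1 ha).1) (Finset.mem_inter.1 ha).2
  calc K ∩ T.bag t
      = K ∩ T.bag (T.child t j) ∩ T.bag (T.child t j) ∩ T.bag t := by
        rw [Finset.inter_assoc K, Finset.inter_self, Finset.inter_right_comm,
          Finset.inter_eq_left.2 hKt]
    _ = r.1 ∩ T.bag (T.child t j) ∩ T.bag t := by rw [hKs, hA.interp_agree t r hr s hs j]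
    _ = r.1 ∩ T.bag (T.child t j) := by
        rw [Finset.inter_right_comm, Finset.inter_eq_left.2 (hA.interp_subset_bag t r hr)]

namespace IsExtension

theorem interp_subset_atomsBelow (hA : IsCoherent A i T) {t : T.Node} {r : Row α β}
    {X : Finset (T.Node × Row α β)} (h : IsExtension A i T t r X)
    (hr : r ∈ consTables A i T t) : interp X ⊆ T.atomsBelow t := by
  have hrow : ∀ {t r}, r ∈ consTables A i T t → r.1 ⊆ T.atomsBelow t := fun {t r} hr =>
    (hA.interp_subset_bag t r hr).trans (T.bag_subset_atomsBelow t)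
  induction h with
  | leaf t r _ => exact interp_singleton t r ▸ hrow hr
  | node t r _ s hs Z _ ih =>
    rw [interp_union_biUnion]
    exact Finset.union_subset (hrow hr) (Finset.biUnion_subset.2 fun j _ =>
      (ih j (mem_consTables_of_mem_orig hs j)).trans (BagTree.atomsBelow_child_subset t j))

theorem interp_inter_bag (hT : T.RunningIntersection) (hA : IsCoherent A i T) {t : T.Node}
    {r : Row α β} {X : Finset (T.Node × Row α β)} (h : IsExtension A i T t r X)
    (hr : r ∈ consTables A i T t) : interp X ∩ T.bag t = r.1 := by
  induction h with
  | leaf t r _ =>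
    rw [interp_singleton, Finset.inter_eq_left.2 (hA.interp_subset_bag t r hr)]
  | node t r _ s hs Z hZ ih =>
    have hchild : ∀ j, interp (Z j) ∩ T.bag t ⊆ r.1 := fun j => by
      have hsj := mem_consTables_of_mem_orig hs j
      rw [hA.inter_bag_eq hT hr hs ((hZ j).interp_subset_atomsBelow hA hsj) (ih j hsj)]
      exact Finset.inter_subset_left
    rw [interp_union_biUnion, glue_inter, Finset.inter_eq_left.2 (hA.interp_subset_bag t r hr)]
    exact Finset.union_eq_left.2 (Finset.biUnion_subset.2 fun j _ => hchild j)

end IsExtension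

theorem subset_atomsBelow_of_mem_projInterps (hA : IsCoherent A i T) {t : T.Node}
    {r : Row α β} {K : Finset α} (hr : r ∈ consTables A i T t)
    (hK : K ∈ projInterps A i T t r) : K ⊆ T.atomsBelow t := by
  obtain ⟨X, hX, rfl⟩ := mem_projInterps.1 hK
  have hX := (mem_satExtensions_singleton.1 hX).1
  exact Finset.inter_subset_left.trans (hX.interp_subset_atomsBelow hA hr)

theorem inter_bag_of_mem_projInterps (hT : T.RunningIntersection) (hA : IsCoherent A i T)
    {t : T.Node} {r : Row α β} {K : Finset α} (hr : r ∈ consTables A i T t)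
    (hK : K ∈ projInterps A i T t r) : K ∩ T.bag t = r.1 ∩ i.proj := by
  obtain ⟨X, hX, rfl⟩ := mem_projInterps.1 hK
  have hX := (mem_satExtensions_singleton.1 hX).1
  rw [Finset.inter_right_comm, hX.interp_inter_bag hT hA hr]

theorem inter_bag_of_mem_projInterps_child (hT : T.RunningIntersection) (hA : IsCoherent A i T)
    {t : T.Node} {r : Row α β} (hr : r ∈ consTables A i T t) {s : Fin (T.arity t) → Row α β}
    (hs : s ∈ orig A i T t r) {j : Fin (T.arity t)} {K : Finset α}
    (hK : K ∈ projInterps A i T (T.child t j) (s j)) :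
    K ∩ T.bag t = r.1 ∩ i.proj ∩ T.bag (T.child t j) := by
  obtain ⟨X, hX, rfl⟩ := mem_projInterps.1 hK
  have hX := (mem_satExtensions_singleton.1 hX).1
  have hsj := mem_consTables_of_mem_orig hs j
  rw [Finset.inter_right_comm, hA.inter_bag_eq hT hr hs (hX.interp_subset_atomsBelow hA hsj)
    (hX.interp_inter_bag hT hA hsj), Finset.inter_right_comm]

theorem injOn_glue (hT : T.RunningIntersection) (hA : IsCoherent A i T) {t : T.Node}
    {ρ : Finset (Row α β)} {Q : Finset α} (hρ : ρ ⊆ consTables A i T t)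
    (hQ : ∀ r ∈ ρ, r.1 ∩ i.proj = Q) :
    Set.InjOn (glue Q) ((origs A i T t ρ).biUnion (childInterps A i T t) :
      Set (Fin (T.arity t) → Finset α)) := by
  have hrecover : ∀ K ∈ (origs A i T t ρ).biUnion (childInterps A i T t), ∀ j,
      glue Q K ∩ T.atomsBelow (T.child t j) = K j := by
    intro K hK
    obtain ⟨s, hs, hKs⟩ := Finset.mem_biUnion.1 hK
    obtain ⟨r, hr, hsr⟩ := Finset.mem_biUnion.1 hs
    have hKs := Fintype.mem_piFinset.1 hKs
    obtain rfl := hQ r hr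
    refine hT.glue_inter_atomsBelow_child ?_ (fun j => ?_) fun j => ?_
    · exact Finset.inter_subset_left.trans (hA.interp_subset_bag t r (hρ hr))
    · exact subset_atomsBelow_of_mem_projInterps hA (mem_consTables_of_mem_orig hsr j) (hKs j)
    · exact inter_bag_of_mem_projInterps_child hT hA (hρ hr) hsr (hKs j)
  intro K hK K' hK' hglue
  funext j
  rw [← hrecover K hK j, ← hrecover K' hK' j, hglue]

end Coherence

section SecondPass

variable {α : Type u} {β : Type v} {A : ConsAlgorithm α β} {i : Instance α} {T : BagTree α}

theorem mem_subBuckets {P : Finset α} {ν ρ : Finset (Row α β)} :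
    ρ ∈ subBuckets P ν ↔ ρ.Nonempty ∧ ρ ⊆ ν ∧ ∃ Q, ∀ r ∈ ρ, r.1 ∩ P = Q := by
  simp only [subBuckets, buckets, Finset.mem_biUnion, Finset.mem_image, Finset.mem_filter,
    Finset.mem_powerset]
  constructor
  · rintro ⟨_, ⟨r₀, _, rfl⟩, hsub, hne⟩
    exact ⟨hne, hsub.trans (Finset.filter_subset _ _), r₀.1 ∩ P, fun r hr =>
      (Finset.mem_filter.1 (hsub hr)).2⟩
  · rintro ⟨⟨r₀, hr₀⟩, hsub, Q, hQ⟩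
    exact ⟨_, ⟨r₀, hsub hr₀, rfl⟩, fun r hr =>
      Finset.mem_filter.2 ⟨hsub hr, (hQ r hr).trans (hQ r₀ hr₀).symm⟩, r₀, hr₀⟩

theorem mem_subBuckets_of_subset {P : Finset α} {ν ρ φ : Finset (Row α β)}
    (hρ : ρ ∈ subBuckets P ν) (hφρ : φ ⊆ ρ) (hφ : φ.Nonempty) : φ ∈ subBuckets P ν := by
  obtain ⟨-, hsub, Q, hQ⟩ := mem_subBuckets.1 hρ
  exact mem_subBuckets.2 ⟨hφ, hφρ.trans hsub, Q, fun r hr => hQ r (hφρ hr)⟩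

theorem projTables_eq (t : T.Node) :
    projTables A i T t = (subBuckets i.proj (purgedTables A i T t)).image fun ρ =>
      (ρ, ipmc A i T t (fun j => projTables A i T (T.child t j)) ρ) :=
  dp_eq (proj A i) i T (purgedTables A i T) t

theorem sipmc_image (B : Finset (Finset (Row α β))) (f : Finset (Row α β) → ℕ)
    (ρ : Finset (Row α β)) :
    sipmc (B.image fun ρ => (ρ, f ρ)) ρ = if ρ ∈ B then f ρ else 0 := by
  rw [sipmc, Finset.sum_filter, Finset.sum_image fun x _ y _ h => (Prod.mk.inj h).1]
  simp

theorem ipmc_of_isLeaf {t : T.Node} (ht : T.IsLeaf t)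
    (π : Fin (T.arity t) → Finset (ProjRow α β)) (ρ : Finset (Row α β)) :
    ipmc A i T t π ρ = 1 := by
  rw [ipmc, if_pos ht]

theorem ipmc_of_not_isLeaf {t : T.Node} (ht : ¬ T.IsLeaf t)
    (π : Fin (T.arity t) → Finset (ProjRow α β)) (ρ : Finset (Row α β)) :
    ipmc A i T t π ρ = (pmc A i T t π ρ + ∑ φ ∈ ρ.ssubsets.filter Finset.Nonempty,
      (-1) ^ φ.card * (ipmc A i T t π φ : ℤ)).natAbs := by
  rw [ipmc, if_neg ht,
    Finset.sum_attach _ fun φ => (-1 : ℤ) ^ φ.card * (ipmc A i T t π φ : ℤ)]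

/-- The table `π` for `t` stores, for every set of rows, the number of their common projected
interpretations; in particular, it stores `0` for a set that is not a sub-bucket of the purged
table. -/
def StoresIntersectionCounts (A : ConsAlgorithm α β) (i : Instance α) (T : BagTree α)
    (t : T.Node) (π : Finset (ProjRow α β)) : Prop :=
  ∀ ρ ⊆ consTables A i T t, sipmc π ρ = (biInter ρ (projInterps A i T t)).card

theorem sipmcSeq_eq_card_biInter (hT : T.RunningIntersection) (hA : IsCoherent A i T)
    {t : T.Node} {π : Fin (T.arity t) → Finset (ProjRow α β)}
    (hπ : ∀ j, StoresIntersectionCounts A i T (T.child t j) (π j)) {ρ : Finset (Row α β)}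
    {Q : Finset α} (hρ : ρ ⊆ consTables A i T t) (hQ : ∀ r ∈ ρ, r.1 ∩ i.proj = Q)
    {O : Finset (Fin (T.arity t) → Row α β)} (hO : O ⊆ origs A i T t ρ) (hne : O.Nonempty) :
    sipmcSeq π O = (biInter O fun s => (childInterps A i T t s).image (glue Q)).card := by
  have hinj : Set.InjOn (glue Q)
      (O.biUnion (childInterps A i T t) : Set (Fin (T.arity t) → Finset α)) :=
    (injOn_glue hT hA hρ hQ).mono
      (Finset.coe_subset.2 (Finset.biUnion_subset_biUnion_of_subset_left _ hO))
  have hinter : (biInter O (childInterps A i T t) : Set (Fin (T.arity t) → Finset α)) ⊆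
      O.biUnion (childInterps A i T t) := Finset.filter_subset _ _
  rw [biInter_image hinj, Finset.card_image_of_injOn (hinj.mono hinter)]
  unfold childInterps
  rw [biInter_piFinset hne fun j => projInterps A i T (T.child t j), Fintype.card_piFinset]
  refine Finset.prod_congr rfl fun j _ => hπ j _ (Finset.image_subset_iff.2 fun s hs => ?_)
  obtain ⟨r, _, hsr⟩ := Finset.mem_biUnion.1 (hO hs)
  exact mem_consTables_of_mem_orig hsr j

theorem pmc_eq_card_biUnion (hT : T.RunningIntersection) (hA : IsCoherent A i T)
    {t : T.Node} (ht : ¬ T.IsLeaf t) {π : Fin (T.arity t) → Finset (ProjRow α β)}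
    (hπ : ∀ j, StoresIntersectionCounts A i T (T.child t j) (π j)) {ρ : Finset (Row α β)}
    (hρ : ρ ∈ subBuckets i.proj (purgedTables A i T t)) :
    pmc A i T t π ρ = ((ρ.biUnion (projInterps A i T t)).card : ℤ) := by
  obtain ⟨-, hsub, Q, hQ⟩ := mem_subBuckets.1 hρ
  rw [biUnion_projInterps_of_not_isLeaf ht hsub hQ, card_biUnion_eq_sum_card_biInter, pmc]
  refine Finset.sum_congr rfl fun O hO => ?_
  obtain ⟨hO, hne⟩ := Finset.mem_filter.1 hO
  rw [sipmcSeq_eq_card_biInter hT hA hπ (hsub.trans (purgedTables_subset_consTables t)) hQ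
    (Finset.mem_powerset.1 hO) hne]

theorem ipmc_eq_card_biInter_of_isLeaf {t : T.Node} (ht : T.IsLeaf t)
    (π : Fin (T.arity t) → Finset (ProjRow α β)) {ρ : Finset (Row α β)}
    (hρ : ρ ∈ subBuckets i.proj (purgedTables A i T t)) :
    ipmc A i T t π ρ = (biInter ρ (projInterps A i T t)).card := by
  obtain ⟨hne, hsub, Q, hQ⟩ := mem_subBuckets.1 hρ
  have hconst : ∀ r ∈ ρ, projInterps A i T t r = {Q} := fun r hr => by
    rw [projInterps_of_isLeaf ht (hsub hr), hQ r hr]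
  rw [ipmc_of_isLeaf ht, biInter_congr hconst, biInter_const hne, Finset.card_singleton]

theorem ipmc_eq_card_biInter_of_not_isLeaf (hT : T.RunningIntersection) (hA : IsCoherent A i T)
    {t : T.Node} (ht : ¬ T.IsLeaf t) {π : Fin (T.arity t) → Finset (ProjRow α β)}
    (hπ : ∀ j, StoresIntersectionCounts A i T (T.child t j) (π j)) {ρ : Finset (Row α β)}
    (hρ : ρ ∈ subBuckets i.proj (purgedTables A i T t)) :
    ipmc A i T t π ρ = (biInter ρ (projInterps A i T t)).card := by
  induction ρ using Finset.strongInduction with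
  | H ρ ih =>
    rw [ipmc_of_not_isLeaf ht, pmc_eq_card_biUnion hT hA ht hπ hρ,
      card_biInter_eq_natAbs (mem_subBuckets.1 hρ).1]
    congr 2
    refine Finset.sum_congr rfl fun φ hφ => ?_
    obtain ⟨hφρ, hφ⟩ := Finset.mem_filter.1 hφ
    have hφρ := Finset.mem_ssubsets.1 hφρ
    rw [ih φ hφρ (mem_subBuckets_of_subset hρ hφρ.subset hφ)]

theorem mem_subBuckets_of_mem_biInter (hT : T.RunningIntersection) (hA : IsCoherent A i T)
    {t : T.Node} {ρ : Finset (Row α β)} (hρ : ρ ⊆ consTables A i T t) {K : Finset α}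
    (hK : K ∈ biInter ρ (projInterps A i T t)) :
    ρ ∈ subBuckets i.proj (purgedTables A i T t) := by
  obtain ⟨hne, hK⟩ := mem_biInter.1 hK
  exact mem_subBuckets.2 ⟨hne,
    fun r hr => mem_purgedTables_of_mem_projInterps (hρ hr) (hK r hr), K ∩ T.bag t,
    fun r hr => (inter_bag_of_mem_projInterps hT hA (hρ hr) (hK r hr)).symm⟩

theorem storesIntersectionCounts_projTables (hT : T.RunningIntersection)
    (hA : IsCoherent A i T) (t : T.Node) :
    StoresIntersectionCounts A i T t (projTables A i T t) := by
  induction t using T.isChild_wf.induction with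
  | _ t ih =>
    intro ρ hρ
    rw [projTables_eq, sipmc_image]
    split_ifs with hmem
    · by_cases ht : T.IsLeaf t
      · exact ipmc_eq_card_biInter_of_isLeaf ht _ hmem
      · exact ipmc_eq_card_biInter_of_not_isLeaf hT hA ht (fun j => ih _ ⟨j, rfl⟩) hmem
    · rw [eq_comm, Finset.card_eq_zero, Finset.eq_empty_iff_forall_notMem]
      exact fun K hK => hmem (mem_subBuckets_of_mem_biInter hT hA hρ hK)

theorem sum_projTables_eq_sipmc {t : T.Node} (hcard : (purgedTables A i T t).card ≤ 1) :
    ∑ x ∈ projTables A i T t, x.2 = sipmc (projTables A i T t) (purgedTables A i T t) := by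
  rw [sipmc, Finset.filter_true_of_mem]
  intro x hx
  rw [projTables_eq] at hx
  obtain ⟨ρ, hρ, rfl⟩ := Finset.mem_image.1 hx
  obtain ⟨hne, hsub, -⟩ := mem_subBuckets.1 hρ
  exact Finset.eq_of_subset_of_card_le hsub (hcard.trans hne.card_pos)

end SecondPass

theorem AdmissibleOn.interpretations_root {α : Type u} {β : Type v} {A : ConsAlgorithm α β}
    {i : Instance α} {T : BagTree α} (hA : AdmissibleOn A i T)
    (hT : T.IsTreeDecomposition (primalGraph i.prog)) :
    interpretations (satExtensions A i T T.root (consTables A i T T.root)) =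
      {I | IsAnswerSet i.prog I} := by
  have hatoms : T.atomsBelow T.root = atoms i.prog :=
    Finset.coe_injective hT.coe_atomsBelow_root
  rw [hA.interp_eq, hatoms]
  ext I
  simp only [Finset.sdiff_self, Finset.union_empty, Set.mem_ofPred_eq]
  constructor
  · rintro ⟨_, _, I', hI', hII', hI'I⟩
    rwa [subset_antisymm hII' hI'I]
  · intro hI
    exact ⟨hI.subset_atoms, fun r hr => hI.isModel r (BagTree.programBelow_subset _ _ hr), I, hI,
      subset_rfl, subset_rfl⟩

end PAS

end

theorem mainTheorem6_general {α : Type*} {β : Type*} {A : PAS.ConsAlgorithm α β}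
    {i : PAS.Instance α} {T : PAS.BagTree α} (hT : T.RunningIntersection)
    (hA : PAS.IsCoherent A i T)
    (hroot : PAS.interpretations
      (PAS.satExtensions A i T T.root (PAS.consTables A i T T.root)) =
        {I | PAS.IsAnswerSet i.prog I})
    (hcard : (PAS.localTable T.root
      (PAS.satExtensions A i T T.root (PAS.consTables A i T T.root))).encard ≤ 1) :
    PAS.sipmc (PAS.projTables A i T T.root) (PAS.purgedTables A i T T.root) =
        PAS.projectedCount i ∧
      ∑ x ∈ PAS.projTables A i T T.root, x.2 = PAS.projectedCount i := by
  have hν := PAS.card_purgedTables_le_one hcard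
  have hstored : PAS.sipmc (PAS.projTables A i T T.root) (PAS.purgedTables A i T T.root) =
      PAS.projectedCount i := by
    rw [PAS.storesIntersectionCounts_projTables hT hA T.root _
        (PAS.purgedTables_subset_consTables T.root), PAS.biInter_eq_biUnion hν,
      PAS.projectedCount_eq_ncard, ← hroot, ← PAS.coe_biUnion_projInterps_purgedTables,
      Set.ncard_coe_finset]
  exact ⟨hstored, (PAS.sum_projTables_eq_sipmc hν).trans hstored⟩

theorem mainTheorem6 {α : Type*} {β : Type*} (A : PAS.ConsAlgorithm α β) :
    (∀ (i : PAS.Instance α) (T : PAS.BagTree α),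
      T.IsNiceTreeDecomposition (PAS.primalGraph i.prog) → PAS.AdmissibleOn A i T →
        PAS.sipmc (PAS.projTables A i T T.root) (PAS.purgedTables A i T T.root) =
            PAS.projectedCount i ∧
        ∑ x ∈ PAS.projTables A i T T.root, x.2 = PAS.projectedCount i) ∧
    (∀ C : Set (PAS.Program α), PAS.Admissible A C →
      ∀ decompose : PAS.Program α → PAS.BagTree α,
        (∀ p ∈ C, (decompose p).IsNiceTreeDecomposition (PAS.primalGraph p)) →
          ∀ i : PAS.Instance α, i.prog ∈ C →
            PAS.mdp A i decompose = PAS.projectedCount i) := by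
  have count := fun (i : PAS.Instance α) (T : PAS.BagTree α)
      (hT : T.IsNiceTreeDecomposition (PAS.primalGraph i.prog)) (hA : PAS.AdmissibleOn A i T) =>
    mainTheorem6_general hT.path_inter hA.isCoherent
      (hA.interpretations_root hT.toIsTreeDecomposition) (hA.card_le_one T.root (Or.inl rfl))
  exact ⟨count, fun C hC decompose hdec i hi =>
    (count i _ (hdec _ hi) (hC i hi _ (hdec _ hi))).2⟩
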